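/- Let $R$ be a commutative Noetherian local ring with maximal ideal $\mathfrak m$ and residue field $k$, and suppose that $R$ is Cohen-Macaulay, i.e. $\operatorname{depth} R=\dim R$. Let $\omega$ be a canonical module of $R$, i.e. a finitely generated $R$-module such that $\dim_k \operatorname{Ext}^i_R(k,\omega)$ equals $1$ for $i=\dim R$ and $0$ for every other $i\ge 0$. For $n\ge 0$ let $\Omega_n^R(\omega)$ denote the $n$-th syzygy module of $\omega$, i.e. the image of the $n$-th differential of an augmented minimal free resolution $$\cdots\to F_2\to F_1\to F_0\to\omega\to 0$$ of $\omega$, where the $0$-th differential is the augmentation $F_0\to\omega$ (so $\Omega_0^R(\omega)=\omega$). Then, for any choice of the minimal free resolution, the following statements are equivalent: (i) $R$ is Gorenstein, i.e. $R$ has finite injective dimension as an $R$-module; (ii) $\Omega_n^R(\omega)$ has a non-zero free direct summand for some $n\ge 0$. -/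

import Mathlib

open CategoryTheory CategoryTheory.Abelian IsLocalRing

universe u

namespace LocalAlgebra

section Depth

variable (R : Type u) [CommRing R] [IsLocalRing R]

/-- The depth of a module `M` over a local ring `R`: the supremum of the lengths of the
`M`-regular sequences consisting of elements of the maximal ideal. -/
noncomputable def depth (M : Type u) [AddCommGroup M] [Module R M] : ℕ∞ :=
  ⨆ rs : {rs : List R // (∀ r ∈ rs, r ∈ maximalIdeal R) ∧ RingTheory.Sequence.IsRegular M rs},
    (rs.1.length : ℕ∞)

/-- A (Noetherian) local ring is Cohen-Macaulay if its depth equals its Krull dimension. -/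
def IsCohenMacaulay : Prop :=
  (depth R R : WithBot ℕ∞) = ringKrullDim R

end Depth

/-- A (Noetherian) local ring is Gorenstein if it has finite injective dimension as a module
over itself. -/
def IsGorenstein (R : Type u) [CommRing R] [IsLocalRing R] : Prop :=
  ∃ n : ℕ, HasInjectiveDimensionLE (ModuleCat.of R R) n

open Classical in
/-- A finitely generated module `ω` over a (Noetherian) local ring `(R, 𝔪, k)` is a canonical
module if `dim_k Ext^i_R(k, ω)` is `1` for `i = dim R` and `0` for every other `i`.
As `𝔪` annihilates `Ext^i_R(k, ω)`, its submodules over `R` are its `k`-subspaces, and its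
dimension over `k` is its length over `R`. -/
structure IsCanonicalModule (R : Type u) [CommRing R] [IsLocalRing R]
    (ω : Type u) [AddCommGroup ω] [Module R ω] : Prop where
  finite : Module.Finite R ω
  length_ext : ∀ i : ℕ,
    Module.length R (Ext (ModuleCat.of R (ResidueField R)) (ModuleCat.of R ω) i) =
      if (i : WithBot ℕ∞) = ringKrullDim R then 1 else 0

/-- An augmented minimal free resolution
`⋯ → R ^ rank 2 → R ^ rank 1 → R ^ rank 0 → M → 0` of a module `M` over a local ring `R`:
it is exact, and the image of each `d n` is contained in `𝔪 • R ^ rank n`. -/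
structure MinimalFreeResolution (R : Type u) [CommRing R] [IsLocalRing R]
    (M : Type u) [AddCommGroup M] [Module R M] where
  rank : ℕ → ℕ
  d : ∀ n : ℕ, (Fin (rank (n + 1)) → R) →ₗ[R] (Fin (rank n) → R)
  ε : (Fin (rank 0) → R) →ₗ[R] M
  surjective_ε : Function.Surjective ε
  exact_ε : Function.Exact (d 0) ε
  exact_d : ∀ n : ℕ, Function.Exact (d (n + 1)) (d n)
  minimal : ∀ n : ℕ,
    LinearMap.range (d n) ≤ maximalIdeal R • (⊤ : Submodule R (Fin (rank n) → R))

namespace MinimalFreeResolution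

variable {R : Type u} [CommRing R] [IsLocalRing R] {M : Type u} [AddCommGroup M] [Module R M]

/-- The `n`-th syzygy module `Ω_n(M)`: the image of the `n`-th differential of the augmented
resolution, the `0`-th differential being the augmentation (so that `Ω_0(M) = M`). -/
def syzygy (F : MinimalFreeResolution R M) : ℕ → ModuleCat.{u} R
  | 0 => ModuleCat.of R (LinearMap.range F.ε)
  | n + 1 => ModuleCat.of R (LinearMap.range (F.d n))

end MinimalFreeResolution

/-- The module `N` has a non-zero free direct summand. -/
def HasNonzeroFreeSummand (R : Type u) [CommRing R] (N : Type u) [AddCommGroup N] [Module R N] :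
    Prop :=
  ∃ P Q : Submodule R N, IsCompl P Q ∧ P ≠ ⊥ ∧ Module.Free R P

section Existence

variable (R : Type u) [CommRing R] [IsLocalRing R]

/-- Every finitely generated module over a local ring has a minimal free cover. -/
theorem exists_minimal_cover (M : Type u) [AddCommGroup M] [Module R M] [Module.Finite R M] :
    ∃ (b : ℕ) (f : (Fin b → R) →ₗ[R] M), Function.Surjective f ∧
      LinearMap.ker f ≤ maximalIdeal R • (⊤ : Submodule R (Fin b → R)) := by
  classical
  have hex : ∃ b : ℕ, ∃ f : (Fin b → R) →ₗ[R] M, Function.Surjective f :=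
    Module.Finite.exists_fin' R M
  obtain ⟨f, hf⟩ := Nat.find_spec hex
  have hmin := fun m (hm : m < Nat.find hex) => Nat.find_min hex hm
  generalize Nat.find hex = b at f hf hmin
  refine ⟨b, f, hf, ?_⟩
  intro x hx
  have hall : ∀ i, x i ∈ maximalIdeal R := by
    intro i
    by_contra hi
    have hu : IsUnit (x i) := by simpa [mem_maximalIdeal, mem_nonunits_iff] using hi
    obtain ⟨v, hv⟩ := hu.exists_left_inv
    cases b with
    | zero => exact i.elim0
    | succ c =>
      refine hmin c (Nat.lt_succ_self c)
        ⟨f ∘ₗ Fintype.linearCombination R (fun j => Pi.single (i.succAbove j) (1 : R)), ?_⟩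
      intro m
      obtain ⟨y, rfl⟩ := hf m
      refine ⟨fun j => (y - (y i * v) • x) (i.succAbove j), ?_⟩
      have h0 : f (y - (y i * v) • x) = f y := by
        have : f x = 0 := hx
        simp [this]
      rw [← h0, LinearMap.comp_apply]
      congr 1
      have hi0 : (y - (y i * v) • x) i = 0 := by
        simp [mul_assoc, hv]
      generalize y - (y i * v) • x = z at hi0
      conv_rhs => rw [pi_eq_sum_univ' z, Fin.sum_univ_succAbove _ i, hi0]
      simp only [Fintype.linearCombination_apply, zero_smul, zero_add]
  rw [pi_eq_sum_univ' x]
  exact Submodule.sum_mem _ fun i _ => Submodule.smul_mem_smul (hall i) trivial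

/-- Every finitely generated module over a Noetherian local ring has a minimal free resolution. -/
theorem nonempty_minimalFreeResolution [IsNoetherianRing R]
    (M : Type u) [AddCommGroup M] [Module R M] [Module.Finite R M] :
    Nonempty (MinimalFreeResolution R M) := by
  obtain ⟨b₀, ε, hε, hε'⟩ := exists_minimal_cover R M
  have step : ∀ s : (Σ b : ℕ, Submodule R (Fin b → R)),
      ∃ (c : ℕ) (g : (Fin c → R) →ₗ[R] (Fin s.1 → R)), LinearMap.range g = s.2 ∧
        LinearMap.ker g ≤ maximalIdeal R • (⊤ : Submodule R (Fin c → R)) := by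
    rintro ⟨b, K⟩
    obtain ⟨c, f, hf, hk⟩ := exists_minimal_cover R K
    refine ⟨c, K.subtype ∘ₗ f, ?_, ?_⟩
    · rw [LinearMap.range_comp, LinearMap.range_eq_top.mpr hf, Submodule.map_top,
        Submodule.range_subtype]
    · rwa [LinearMap.ker_comp_of_ker_eq_bot f K.ker_subtype]
  choose c g hg hk using step
  let s : ℕ → (Σ b : ℕ, Submodule R (Fin b → R)) := fun n =>
    Nat.rec ⟨b₀, LinearMap.ker ε⟩ (fun _ t => ⟨c t, LinearMap.ker (g t)⟩) n
  have hs : ∀ n, (s n).2 ≤ maximalIdeal R • (⊤ : Submodule R (Fin (s n).1 → R)) := by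
    intro n
    cases n with
    | zero => exact hε'
    | succ n => exact hk (s n)
  exact ⟨{
    rank := fun n => (s n).1
    d := fun n => g (s n)
    ε := ε
    surjective_ε := hε
    exact_ε := LinearMap.exact_iff.mpr (hg (s 0)).symm
    exact_d := fun n => LinearMap.exact_iff.mpr (hg (s (n + 1))).symm
    minimal := fun n => (hg (s n)).le.trans (hs n) }⟩

end Existence

end LocalAlgebra

/-!
Let `d = dim R`. Over a Cohen-Macaulay ring `R × ω` has depth `d`, so some sequence `rs` of length
`d` is regular on both `R` and `ω`; write `S = R / (rs)`, an Artinian ring, and `W = ω / (rs) ω`.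

If `R` is Gorenstein, dimension shifting along `rs` turns `inj dim R, inj dim ω ≤ d` into
injectivity of `S` and `W` with respect to finitely generated `S`-modules, and turns
`Ext^d(k, ω) ≅ k` into `Hom(k, W) ≅ k`. Extending an embedding `k → S` along the socle `k → W`
gives a map `W → S` that is injective on the simple socle, hence injective, hence split. As `R` is
local, the splitting `S → W` is an isomorphism, and it lifts to `R ≅ ω`.

Conversely, a free summand of `Ω_0(ω) = ω` makes `R` a retract of `ω`, which has finite injective
dimension. For `n ≥ 1` no free summand exists: `Ω_n(ω) ⊆ 𝔪 F` with `F` free and `F / Ω_n(ω)` weakly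
`rs`-regular, so a `t` generating a copy of `k` in `S` sends `Ω_n(ω)` into
`(rs) F ∩ Ω_n(ω) = (rs) Ω_n(ω)`, whereas it does not send `R` into `(rs)`.
-/

namespace LocalAlgebra

open RingTheory.Sequence

section Quotient

variable {R : Type*} [CommRing R]

theorem le_annihilator_quotient_smul_top (I : Ideal R) (N : Type*) [AddCommGroup N] [Module R N] :
    I ≤ Module.annihilator R (N ⧸ I • (⊤ : Submodule R N)) := by
  intro r hr
  rw [Module.mem_annihilator]
  rintro ⟨x⟩
  exact (Submodule.Quotient.mk_eq_zero _).mpr (Submodule.smul_mem_smul hr trivial)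

variable {N : Type*} [AddCommGroup N] [Module R N] {rs : List R}

theorem ofList_ne_top (hN : IsRegular N rs) : Ideal.ofList rs ≠ ⊤ :=
  fun h => hN.top_ne_smul (by rw [h, Submodule.top_smul])

variable [IsLocalRing R]

theorem ofList_le_maximalIdeal (hN : IsRegular N rs) : Ideal.ofList rs ≤ maximalIdeal R :=
  le_maximalIdeal (ofList_ne_top hN)

theorem annihilator_residueField : Module.annihilator R (ResidueField R) = maximalIdeal R :=
  Ideal.annihilator_quotient

end Quotient

section Ext

variable {R : Type u} [CommRing R] {M N : ModuleCat.{u} R}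

theorem smul_ext_eq_zero {r : R} (hr : r ∈ Module.annihilator R M) {i : ℕ} (x : Ext M N i) :
    r • x = 0 := by
  have hid : r • 𝟙 M = 0 := by
    ext m
    exact Module.mem_annihilator.mp hr m
  rw [← Ext.mk₀_id_comp x, ← Ext.smul_comp, ← Ext.mk₀_smul, hid, Ext.mk₀_zero, Ext.zero_comp]

theorem bijective_postcomp_extClass_smulShortComplex {r : R} (hr : r ∈ Module.annihilator R M)
    (hN : IsSMulRegular N r) {i : ℕ} [Subsingleton (Ext M N i)] :
    Function.Bijective
      (hN.smulShortComplex_shortExact.extClass.postcompOfLinear R M (rfl : i + 1 = i + 1)) := by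
  constructor
  · rw [injective_iff_map_eq_zero]
    intro y hy
    obtain ⟨z, rfl⟩ :=
      Ext.covariant_sequence_exact₃ M hN.smulShortComplex_shortExact y rfl hy
    have hz : z = 0 := Subsingleton.elim (α := Ext M N i) z 0
    rw [hz, Ext.zero_comp]
  · have hr_zero (x : Ext M N (i + 1)) : x.comp (Ext.mk₀ (r • 𝟙 N)) (add_zero (i + 1)) = 0 := by
      rw [Ext.mk₀_smul, Ext.comp_smul, Ext.comp_mk₀_id, smul_ext_eq_zero hr]
    exact fun x =>
      Ext.covariant_sequence_exact₁ M hN.smulShortComplex_shortExact x (hr_zero x) rfl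

theorem bijective_postcomp_mk₀_iso {A B : ModuleCat.{u} R} (e : A ≅ B) (i : ℕ) :
    Function.Bijective ((Ext.mk₀ e.hom).postcompOfLinear R M (add_zero i)) := by
  refine Function.bijective_iff_has_inverse.mpr
    ⟨(Ext.mk₀ e.inv).postcompOfLinear R M (add_zero i), fun x => ?_, fun x => ?_⟩ <;> simp

theorem subsingleton_ext_prod {N₁ N₂ : Type u} [AddCommGroup N₁] [Module R N₁]
    [AddCommGroup N₂] [Module R N₂] (i : ℕ) [Subsingleton (Ext M (ModuleCat.of R N₁) i)]
    [Subsingleton (Ext M (ModuleCat.of R N₂) i)] :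
    Subsingleton (Ext M (ModuleCat.of R (N₁ × N₂)) i) := by
  have hS := ModuleCat.shortComplex_shortExact (ModuleCat.shortComplexOfCompEqZero
    (LinearMap.inl R N₁ N₂) (LinearMap.snd R N₁ N₂) Function.Exact.inl_snd.linearMap_comp_eq_zero)
    Function.Exact.inl_snd LinearMap.inl_injective LinearMap.snd_surjective
  refine subsingleton_of_forall_eq 0 fun x => ?_
  obtain ⟨y, rfl⟩ := Ext.covariant_sequence_exact₂ M hS x
    (Subsingleton.elim (α := Ext M (ModuleCat.of R N₂) i) _ _)
  rw [Subsingleton.elim (α := Ext M (ModuleCat.of R N₁) i) y 0, Ext.zero_comp]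

variable [IsNoetherianRing R] [Module.Finite R M] [Module.Finite R N] {rs : List R}

theorem subsingleton_ext_of_isRegular (hM : Ideal.ofList rs ≤ Module.annihilator R M)
    (hN : IsRegular N rs) {i : ℕ} (hi : i < rs.length) : Subsingleton (Ext M N i) := by
  refine ModuleCat.subsingleton_ext_of_exists_isRegular (Ideal.ofList rs) M ?_ N
    hN.top_ne_smul.symm.lt_top rs (fun r hr => Ideal.subset_span hr) hN i hi
  rw [Module.support_eq_zeroLocus]
  exact PrimeSpectrum.zeroLocus_anti_mono hM

theorem exists_bijective_postcomp_of_isRegular (hN : IsRegular N rs) :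
    ∃ δ : Ext (ModuleCat.of R (N ⧸ Ideal.ofList rs • (⊤ : Submodule R N))) N rs.length,
      ∀ M : ModuleCat.{u} R, Module.Finite R M → Ideal.ofList rs ≤ Module.annihilator R M →
        Function.Bijective (δ.postcompOfLinear R M (zero_add rs.length)) := by
  induction rs generalizing N with
  | nil =>
    have hbot : Ideal.ofList ([] : List R) • (⊤ : Submodule R N) = ⊥ := by simp
    let e := (Submodule.quotEquivOfEqBot _ hbot).toModuleIso
    exact ⟨Ext.mk₀ e.hom, fun M _ _ => bijective_postcomp_mk₀_iso e 0⟩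
  | cons r rs ih =>
    have hr : IsSMulRegular N r := ((isRegular_cons_iff N r rs).mp hN).1
    obtain ⟨δ, hδ⟩ :=
      ih (N := ModuleCat.of R (QuotSMulTop r N)) ((isRegular_cons_iff N r rs).mp hN).2
    let δ₁ : Ext (ModuleCat.of R (QuotSMulTop r N)) N 1 :=
      hr.smulShortComplex_shortExact.extClass
    let e := (Submodule.quotOfListConsSMulTopEquivQuotSMulTopInner N r rs).toModuleIso
    refine ⟨(Ext.mk₀ e.hom).comp (δ.comp δ₁ rfl) (zero_add _), fun M _ hM => ?_⟩
    rw [Ideal.ofList_cons, sup_le_iff, Ideal.span_singleton_le_iff_mem] at hM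
    have : Subsingleton (Ext M N rs.length) := subsingleton_ext_of_isRegular
      (by simpa [Ideal.ofList_cons] using hM) hN (by simp)
    have hbij := (bijective_postcomp_extClass_smulShortComplex hM.1 hr).comp
      ((hδ M inferInstance hM.2).comp (bijective_postcomp_mk₀_iso e 0))
    refine (congrArg Function.Bijective (funext fun f => ?_)).mp hbij
    exact (Ext.comp_assoc (f.comp (Ext.mk₀ e.hom) (add_zero 0)) δ δ₁ (zero_add _) rfl
      (by omega)).trans (Ext.comp_assoc_of_second_deg_zero ..)

end Ext

section RelativeInjectivity

variable {R : Type u} [CommRing R] [IsNoetherianRing R] {M N : Type u} [AddCommGroup M]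
  [Module R M] [Module.Finite R M] [AddCommGroup N] [Module R N] [Module.Finite R N] {rs : List R}

theorem nonempty_linearMap_quotient_equiv_ext (hM : Ideal.ofList rs ≤ Module.annihilator R M)
    (hN : IsRegular N rs) :
    Nonempty ((M →ₗ[R] N ⧸ Ideal.ofList rs • (⊤ : Submodule R N)) ≃ₗ[R]
      Ext (ModuleCat.of R M) (ModuleCat.of R N) rs.length) := by
  obtain ⟨δ, hδ⟩ := exists_bijective_postcomp_of_isRegular (N := ModuleCat.of R N) hN
  exact ⟨(ModuleCat.homLinearEquiv (S := R) (M := ModuleCat.of R M)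
    (N := ModuleCat.of R (N ⧸ _))).symm ≪≫ₗ Ext.linearEquiv₀.symm ≪≫ₗ LinearEquiv.ofBijective _
      (hδ (ModuleCat.of R M) inferInstance hM)⟩

theorem exists_extension_of_hasInjectiveDimensionLE_length (hN : IsRegular N rs)
    [HasInjectiveDimensionLE (ModuleCat.of R N) rs.length]
    (hM : Ideal.ofList rs ≤ Module.annihilator R M) {L : Type u} [AddCommGroup L] [Module R L]
    {j : L →ₗ[R] M} (hj : Function.Injective j)
    (f : L →ₗ[R] N ⧸ Ideal.ofList rs • (⊤ : Submodule R N)) :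
    ∃ g : M →ₗ[R] N ⧸ Ideal.ofList rs • (⊤ : Submodule R N), g ∘ₗ j = f := by
  have : Module.Finite R L := Module.Finite.of_injective j hj
  have hL : Ideal.ofList rs ≤ Module.annihilator R L :=
    hM.trans (LinearMap.annihilator_le_of_injective j hj)
  obtain ⟨δ, hδ⟩ := exists_bijective_postcomp_of_isRegular (N := ModuleCat.of R N) hN
  have hS := ModuleCat.shortComplex_shortExact (ModuleCat.shortComplexOfCompEqZero j
    (LinearMap.range j).mkQ (LinearMap.exact_map_mkQ_range j).linearMap_comp_eq_zero)
    (LinearMap.exact_map_mkQ_range j) hj (Submodule.mkQ_surjective _)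
  obtain ⟨y, hy⟩ := Ext.contravariant_sequence_exact₁ hS (ModuleCat.of R N)
    ((Ext.mk₀ (ModuleCat.ofHom f)).comp δ (zero_add _)) (add_comm 1 _)
    (Ext.eq_zero_of_hasInjectiveDimensionLT _ (rs.length + 1) le_rfl)
  obtain ⟨g', rfl⟩ := (hδ (ModuleCat.of R M) inferInstance hM).surjective y
  obtain ⟨g, rfl⟩ := (Ext.mk₀_bijective _ _).surjective g'
  refine ⟨g.hom, ?_⟩
  have hcomp : Ext.mk₀ (ModuleCat.ofHom j ≫ g) = Ext.mk₀ (ModuleCat.ofHom f) := by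
    refine (hδ (ModuleCat.of R L) inferInstance hL).injective (Eq.trans ?_ hy)
    exact (Ext.mk₀_comp_mk₀_assoc _ _ δ).symm
  exact congrArg ModuleCat.Hom.hom ((Ext.mk₀_bijective _ _).injective hcomp)

end RelativeInjectivity

section InjectiveDimension

variable {R : Type u} [CommRing R] {N : ModuleCat.{u} R}

theorem injective_of_subsingleton_ext_quotient
    (h : ∀ I : Ideal R, Subsingleton (Ext (ModuleCat.of R (R ⧸ I)) N 1)) : Injective N := by
  rw [← Module.injective_iff_injective_object, ← Module.Baer.iff_injective]
  intro I g
  have hS := ModuleCat.shortComplex_shortExact (ModuleCat.shortComplexOfCompEqZero I.subtype I.mkQ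
    (LinearMap.exact_subtype_mkQ I).linearMap_comp_eq_zero)
    (LinearMap.exact_subtype_mkQ I) I.injective_subtype (Submodule.mkQ_surjective _)
  obtain ⟨y, hy⟩ := Ext.contravariant_sequence_exact₁ hS N (Ext.mk₀ (ModuleCat.ofHom g))
    (add_zero 1) ((h I).elim _ _)
  obtain ⟨g', rfl⟩ := (Ext.mk₀_bijective _ _).surjective y
  have hg' : ModuleCat.ofHom I.subtype ≫ g' = ModuleCat.ofHom g :=
    (Ext.mk₀_bijective _ _).injective ((Ext.mk₀_comp_mk₀ _ _).symm.trans hy)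
  exact ⟨g'.hom, fun x hx => congrArg (fun t => t.hom (⟨x, hx⟩ : I)) hg'⟩

theorem hasInjectiveDimensionLE_of_subsingleton_ext_quotient {d : ℕ}
    (h : ∀ I : Ideal R, Subsingleton (Ext (ModuleCat.of R (R ⧸ I)) N (d + 1))) :
    HasInjectiveDimensionLE N d := by
  induction d generalizing N with
  | zero =>
    exact injective_iff_hasInjectiveDimensionLT_one.mp (injective_of_subsingleton_ext_quotient h)
  | succ d ih =>
    obtain ⟨J, _, f, _⟩ := EnoughInjectives.presentation N
    have hS := ShortComplex.ShortExact.mk' (ShortComplex.exact_cokernel f) ‹_› inferInstance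
    refine (hS.hasInjectiveDimensionLT_X₃_iff d ‹Injective J›).mp
      (ih fun I => subsingleton_of_forall_eq 0 fun x => ?_)
    obtain ⟨y, rfl⟩ := Ext.covariant_sequence_exact₃ _ hS x rfl ((h I).elim _ _)
    have hy : y = 0 := Ext.eq_zero_of_injective (I := J) y
    rw [hy, Ext.zero_comp]

theorem subsingleton_ext_of_injective {L M : Type u} [AddCommGroup L] [Module R L]
    [AddCommGroup M] [Module R M] {j : L →ₗ[R] M} (hj : Function.Injective j) (i : ℕ)
    [HasInjectiveDimensionLE N i] [Subsingleton (Ext (ModuleCat.of R M) N i)] :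
    Subsingleton (Ext (ModuleCat.of R L) N i) := by
  have hS := ModuleCat.shortComplex_shortExact (ModuleCat.shortComplexOfCompEqZero j
    (LinearMap.range j).mkQ (LinearMap.exact_map_mkQ_range j).linearMap_comp_eq_zero)
    (LinearMap.exact_map_mkQ_range j) hj (Submodule.mkQ_surjective _)
  refine subsingleton_of_forall_eq 0 fun x => ?_
  obtain ⟨y, rfl⟩ := Ext.contravariant_sequence_exact₁ hS N x (add_comm 1 i)
    (Ext.eq_zero_of_hasInjectiveDimensionLT _ (i + 1) le_rfl)
  rw [Subsingleton.elim (α := Ext (ModuleCat.of R M) N i) y 0, Ext.comp_zero]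

variable {M : Type u} [AddCommGroup M] [Module R M] [Module.Finite R M] {i : ℕ}

theorem subsingleton_ext_of_forall_isPrime [IsNoetherianRing R]
    (h : ∀ p : Ideal R, p.IsPrime → Module.annihilator R M ≤ p →
      Subsingleton (Ext (ModuleCat.of R (R ⧸ p)) N i)) :
    Subsingleton (Ext (ModuleCat.of R M) N i) := by
  induction ‹Module.Finite R M› using
    IsNoetherianRing.induction_on_isQuotientEquivQuotientPrime R with
  | subsingleton M =>
    refine subsingleton_of_forall_eq 0 fun x => ?_
    rw [← one_smul R x]
    exact smul_ext_eq_zero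
      (by simp [Module.mem_annihilator, eq_iff_true_of_subsingleton]) x
  | quotient M p e =>
    have := h p.1 p.2 (by rw [e.annihilator_eq, Ideal.annihilator_quotient])
    refine subsingleton_of_forall_eq 0 fun x => ?_
    have he : (Ext.mk₀ e.toModuleIso.hom).comp ((Ext.mk₀ e.toModuleIso.inv).comp x (zero_add i))
        (zero_add i) = x := by
      rw [← Ext.comp_assoc_of_second_deg_zero, Ext.mk₀_comp_mk₀, Iso.hom_inv_id, Ext.mk₀_id_comp]
    rw [← he, Subsingleton.elim ((Ext.mk₀ e.toModuleIso.inv).comp x _) 0, Ext.comp_zero]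
  | exact M₁ M₂ M₃ f g hf hg hfg h₁ h₃ =>
    have := h₁ fun p hp hpM => h p hp ((LinearMap.annihilator_le_of_injective f hf).trans hpM)
    have := h₃ fun p hp hpM => h p hp ((LinearMap.annihilator_le_of_surjective g hg).trans hpM)
    refine subsingleton_of_forall_eq 0 fun x => ?_
    obtain ⟨y, rfl⟩ := Ext.contravariant_sequence_exact₂
      (ModuleCat.shortComplex_shortExact
        (ModuleCat.shortComplexOfCompEqZero f g hfg.linearMap_comp_eq_zero) hfg hf hg) N x
      (Subsingleton.elim (α := Ext (ModuleCat.of R M₁) N i) _ _)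
    rw [Subsingleton.elim (α := Ext (ModuleCat.of R M₃) N i) y 0, Ext.comp_zero]

variable [IsLocalRing R] [IsNoetherianRing R] [Module.Finite R N]

theorem subsingleton_ext_of_quotSMulTop {r : R} (hr : r ∈ maximalIdeal R)
    (hM : IsSMulRegular M r)
    [Subsingleton (Ext (ModuleCat.of R (QuotSMulTop r M)) N (i + 1))] :
    Subsingleton (Ext (ModuleCat.of R M) N i) := by
  have hsurj (x : Ext (ModuleCat.of R M) N i) : ∃ y, r • y = x := by
    obtain ⟨y, hy⟩ := Ext.contravariant_sequence_exact₁
      (IsSMulRegular.smulShortComplex_shortExact (M := ModuleCat.of R M) hM) N x (add_comm 1 i)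
      (Subsingleton.elim (α := Ext (ModuleCat.of R (QuotSMulTop r M)) N (i + 1)) _ _)
    have hry (z : Ext (ModuleCat.of R M) N i) :
        (Ext.mk₀ (r • 𝟙 (ModuleCat.of R M))).comp z (zero_add i) = r • z := by
      rw [Ext.mk₀_smul, Ext.smul_comp, Ext.mk₀_id_comp]
    exact ⟨y, (hry y).symm.trans hy⟩
  have hle : (⊤ : Submodule R (Ext (ModuleCat.of R M) N i)) ≤ maximalIdeal R • ⊤ := by
    rintro x -
    obtain ⟨y, rfl⟩ := hsurj x
    exact Submodule.smul_mem_smul hr trivial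
  have hbot := Submodule.eq_bot_of_le_smul_of_le_jacobson_bot _ _ Module.Finite.fg_top hle
    (maximalIdeal_le_jacobson _)
  exact (Submodule.subsingleton_iff R).mp (subsingleton_of_bot_eq_top hbot.symm)

theorem subsingleton_ext_quotient_of_isPrime {d : ℕ}
    (h : ∀ i, d < i → Subsingleton (Ext (ModuleCat.of R (ResidueField R)) N i))
    {p : Ideal R} (hp : p.IsPrime) (hi : d < i) :
    Subsingleton (Ext (ModuleCat.of R (R ⧸ p)) N i) := by
  induction p using WellFoundedGT.induction generalizing i with
  | ind p ih =>
    rcases (le_maximalIdeal hp.ne_top).eq_or_lt with rfl | hlt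
    · exact h i hi
    obtain ⟨r, hr, hrp⟩ := SetLike.exists_of_lt hlt
    have hreg : IsSMulRegular (R ⧸ p) r := by
      rw [isSMulRegular_iff_right_eq_zero_of_smul]
      rintro ⟨s⟩ hs
      exact Ideal.Quotient.eq_zero_iff_mem.mpr
        ((hp.mem_or_mem (Ideal.Quotient.eq_zero_iff_mem.mp hs)).resolve_left hrp)
    have : Subsingleton (Ext (ModuleCat.of R (QuotSMulTop r (R ⧸ p))) N (i + 1)) := by
      refine subsingleton_ext_of_forall_isPrime fun q hq hann => ih q ?_ hq (by omega)
      have hpq : p ≤ q := by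
        rw [← Ideal.annihilator_quotient (I := p)]
        exact (LinearMap.annihilator_le_of_surjective _ (Submodule.mkQ_surjective _)).trans hann
      exact hpq.lt_of_ne fun hpq' => hrp (hpq'.symm ▸ hann (QuotSMulTop.mem_annihilator _ r))
    exact subsingleton_ext_of_quotSMulTop hr hreg

theorem hasInjectiveDimensionLE_of_subsingleton_ext_residueField {d : ℕ}
    (h : ∀ i, d < i → Subsingleton (Ext (ModuleCat.of R (ResidueField R)) N i)) :
    HasInjectiveDimensionLE N d :=
  hasInjectiveDimensionLE_of_subsingleton_ext_quotient fun _ =>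
    subsingleton_ext_of_forall_isPrime fun _ hp _ =>
      subsingleton_ext_quotient_of_isPrime h hp (Nat.lt_succ_self d)

end InjectiveDimension

section ZeroDimensionalQuotient

variable {R : Type u} [CommRing R] [IsLocalRing R]

theorem eq_maximalIdeal_of_krullDimLE_zero_quotient {I p : Ideal R} [Ring.KrullDimLE 0 (R ⧸ I)]
    (hp : p.IsPrime) (hIp : I ≤ p) : p = maximalIdeal R := by
  have : Ring.KrullDimLE 0 (R ⧸ p) := Ring.krullDimLE_iff.mpr
    ((ringKrullDim_le_of_surjective _ (Ideal.Quotient.factor_surjective hIp)).trans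
      (Ring.krullDimLE_iff.mp ‹_›))
  exact eq_maximalIdeal (Ideal.Quotient.maximal_of_isField p Ring.KrullDimLE.isField_of_isDomain)

variable [IsNoetherianRing R]

theorem krullDimLE_zero_quotient_ofList {rs : List R} (hrs : IsRegular R rs)
    (hd : ringKrullDim R = rs.length) : Ring.KrullDimLE 0 (R ⧸ Ideal.ofList rs) := by
  have h := ringKrullDim_add_length_eq_ringKrullDim_of_isRegular rs hrs
  rw [Ring.krullDimLE_iff, ← ENat.WithBot.add_le_add_natCast_right_iff (c := rs.length), h, hd]
  simp

theorem exists_injective_residueField (I : Ideal R) [Ring.KrullDimLE 0 (R ⧸ I)] {M : Type*}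
    [AddCommGroup M] [Module R M] [Nontrivial M] (hM : I ≤ Module.annihilator R M) :
    ∃ f : ResidueField R →ₗ[R] M, Function.Injective f := by
  obtain ⟨p, hp⟩ := associatedPrimes.nonempty R M
  obtain rfl := eq_maximalIdeal_of_krullDimLE_zero_quotient hp.isPrime
    (hM.trans (Submodule.annihilator_top.symm.le.trans hp.annihilator_le))
  exact ((isAssociatedPrime_iff_exists_injective_linearMap _ _).mp hp).2

theorem injective_of_isSimpleModule_socle (I : Ideal R) [Ring.KrullDimLE 0 (R ⧸ I)]
    {W V : Type*} [AddCommGroup W] [Module R W] [AddCommGroup V] [Module R V]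
    (hW : I ≤ Module.annihilator R W) [IsSimpleModule R (ResidueField R →ₗ[R] W)]
    {g : W →ₗ[R] V} {j : ResidueField R →ₗ[R] W} (hgj : g ∘ₗ j ≠ 0) : Function.Injective g := by
  have hinj : Function.Injective (LinearMap.compRight R (M := ResidueField R) g) :=
    LinearMap.injective_of_ne_zero fun h => hgj (LinearMap.congr_fun h j)
  rw [← LinearMap.ker_eq_bot]
  by_contra hker
  have : Nontrivial (LinearMap.ker g) := Submodule.nontrivial_iff_ne_bot.mpr hker
  obtain ⟨f, hf⟩ := exists_injective_residueField I
    (hW.trans (LinearMap.annihilator_le_of_injective _ (LinearMap.ker g).injective_subtype))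
  have hf0 : (LinearMap.ker g).subtype ∘ₗ f = 0 := by
    refine hinj ?_
    ext
    simp
  exact one_ne_zero (hf (Subtype.ext (by simpa using LinearMap.congr_fun hf0 1)))

theorem exists_notMem_forall_mul_mem {I : Ideal R} [Ring.KrullDimLE 0 (R ⧸ I)] (hI : I ≠ ⊤) :
    ∃ t ∉ I, ∀ r ∈ maximalIdeal R, r * t ∈ I := by
  have : Nontrivial (R ⧸ I) := Ideal.Quotient.nontrivial_iff.mpr hI
  obtain ⟨s, hs⟩ := exists_injective_residueField I (Ideal.annihilator_quotient (I := I)).ge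
  obtain ⟨t, ht⟩ := Ideal.Quotient.mk_surjective (s 1)
  refine ⟨t, fun htI => one_ne_zero (hs ?_), fun r hr => ?_⟩
  · rw [← ht, Ideal.Quotient.eq_zero_iff_mem.mpr htI, map_zero]
  · have hr0 : r • (1 : ResidueField R) = 0 := by
      rw [Algebra.smul_def, mul_one]
      exact (residue_eq_zero_iff r).mpr hr
    rw [← Ideal.Quotient.eq_zero_iff_mem]
    calc Ideal.Quotient.mk I (r * t) = r • s 1 := by rw [← ht]; rfl
      _ = 0 := by rw [← map_smul, hr0, map_zero]

theorem hasProjectiveDimensionLE_quotient_ofList {rs : List R} (hrs : IsRegular R rs) :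
    HasProjectiveDimensionLE (ModuleCat.of R (R ⧸ Ideal.ofList rs)) rs.length := by
  rw [← projectiveDimension_le_iff,
    ModuleCat.projectiveDimension_eq_of_linearEquiv
      (N := ModuleCat.of R (Shrink.{u} (R ⧸ Ideal.ofList rs)))
      (Shrink.linearEquiv R (R ⧸ Ideal.ofList rs)).symm]
  exact (ModuleCat.projectiveDimension_quotient_eq_length rs hrs).le

theorem hasInjectiveDimensionLE_of_succ {rs : List R} (hrs : IsRegular R rs)
    [Ring.KrullDimLE 0 (R ⧸ Ideal.ofList rs)] {N : ModuleCat.{u} R} [Module.Finite R N] {n : ℕ}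
    (hn : rs.length ≤ n) [HasInjectiveDimensionLE N (n + 1)] : HasInjectiveDimensionLE N n := by
  have : Nontrivial (R ⧸ Ideal.ofList rs) :=
    Ideal.Quotient.nontrivial_iff.mpr (ofList_ne_top hrs)
  obtain ⟨s, hs⟩ := exists_injective_residueField (M := R ⧸ Ideal.ofList rs) (Ideal.ofList rs)
    (Ideal.annihilator_quotient (I := Ideal.ofList rs)).ge
  have := hasProjectiveDimensionLE_quotient_ofList hrs
  refine hasInjectiveDimensionLE_of_subsingleton_ext_residueField fun i hi => ?_
  have := hasInjectiveDimensionLT_of_ge N (n + 1 + 1) (i + 1) (by omega)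
  have := HasProjectiveDimensionLT.subsingleton (ModuleCat.of R (R ⧸ Ideal.ofList rs))
    (rs.length + 1) i (by omega) N
  exact subsingleton_ext_of_injective hs i

theorem hasInjectiveDimensionLE_length {rs : List R} (hrs : IsRegular R rs)
    [Ring.KrullDimLE 0 (R ⧸ Ideal.ofList rs)] {N : ModuleCat.{u} R} [Module.Finite R N] {n : ℕ}
    (hn : HasInjectiveDimensionLE N n) : HasInjectiveDimensionLE N rs.length := by
  induction n with
  | zero => exact hasInjectiveDimensionLT_of_ge N 1 (rs.length + 1) (by omega)
  | succ n ih =>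
    rcases le_or_gt rs.length n with h | h
    · exact ih (hasInjectiveDimensionLE_of_succ hrs h)
    · exact hasInjectiveDimensionLT_of_ge N (n + 1 + 1) (rs.length + 1) (by omega)

end ZeroDimensionalQuotient

section FreeSummand

variable {R : Type u} [CommRing R] [Nontrivial R] {N : Type u} [AddCommGroup N] [Module R N]

theorem hasNonzeroFreeSummand_iff_exists_surjective :
    HasNonzeroFreeSummand R N ↔ ∃ φ : N →ₗ[R] R, Function.Surjective φ := by
  constructor
  · rintro ⟨P, Q, hPQ, hP, _⟩
    have : Nontrivial P := Submodule.nontrivial_iff_ne_bot.mpr hP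
    let b := Module.Free.chooseBasis R P
    obtain ⟨i⟩ := b.index_nonempty
    exact ⟨b.coord i ∘ₗ P.projectionOnto Q hPQ, fun r => ⟨r • (b i : N), by simp⟩⟩
  · rintro ⟨φ, hφ⟩
    obtain ⟨s, hs⟩ := φ.exists_rightInverse_of_surjective (LinearMap.range_eq_top.mpr hφ)
    have hinj : Function.Injective s := LinearMap.injective_of_comp_eq_id s φ hs
    have hidem : IsIdempotentElem (s ∘ₗ φ) := by
      ext x
      simpa using congrArg s (LinearMap.congr_fun hs (φ x))
    let e := LinearEquiv.ofInjective s hinj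
    refine ⟨LinearMap.range s, LinearMap.ker φ, ?_,
      Submodule.nontrivial_iff_ne_bot.mp e.symm.toEquiv.nontrivial, .of_equiv e⟩
    rw [← LinearMap.range_comp_of_range_eq_top s (LinearMap.range_eq_top.mpr hφ),
      ← LinearMap.ker_comp_of_ker_eq_bot φ (LinearMap.ker_eq_bot.mpr hinj)]
    exact LinearMap.IsIdempotentElem.isCompl hidem

end FreeSummand

section WeaklyRegular

variable {R : Type*} [CommRing R] {L P N : Type*} [AddCommGroup L] [Module R L]
  [AddCommGroup P] [Module R P] [AddCommGroup N] [Module R N] {rs : List R}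

theorem mem_ofList_smul_top_of_exact {f : L →ₗ[R] P} {g : P →ₗ[R] N}
    (hf : Function.Injective f) (hfg : Function.Exact f g) (hg : Function.Surjective g)
    (hN : IsWeaklyRegular N rs) {l : L} (hl : f l ∈ Ideal.ofList rs • (⊤ : Submodule R P)) :
    l ∈ Ideal.ofList rs • (⊤ : Submodule R L) := by
  have hexact := map_first_exact_on_four_term_right_exact_of_isSMulRegular_last
    ((LinearMap.exact_zero_iff_injective PUnit f).mpr hf) hfg hg hN
  obtain ⟨y, hy⟩ := (hexact (Submodule.Quotient.mk l)).mp (by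
    rwa [Submodule.mapQ_apply, Submodule.Quotient.mk_eq_zero])
  obtain ⟨y, rfl⟩ := Submodule.Quotient.mk_surjective _ y
  exact (Submodule.Quotient.mk_eq_zero _).mp hy.symm

theorem isWeaklyRegular_of_exact {f : L →ₗ[R] P} {g : P →ₗ[R] N} (hf : Function.Injective f)
    (hfg : Function.Exact f g) (hg : Function.Surjective g) (hP : IsWeaklyRegular P rs)
    (hN : IsWeaklyRegular N rs) : IsWeaklyRegular L rs := by
  induction rs generalizing L P N with
  | nil => exact .nil R L
  | cons r rs ih =>
    rw [isWeaklyRegular_cons_iff] at hP hN ⊢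
    have hexact := QuotSMulTop.map_first_exact_on_four_term_exact_of_isSMulRegular_last
      ((LinearMap.exact_zero_iff_injective PUnit f).mpr hf) hfg hN.1
    rw [map_zero, LinearMap.exact_zero_iff_injective] at hexact
    exact ⟨hP.1.of_injective f hf, ih hexact (QuotSMulTop.map_exact r hfg hg)
      (QuotSMulTop.map_surjective r hg) hP.2 hN.2⟩

theorem isWeaklyRegular_pi (hR : IsWeaklyRegular R rs) (ι : Type*) [Finite ι] :
    IsWeaklyRegular (ι → R) rs :=
  ((TensorProduct.lid R (ι → R)).isWeaklyRegular_congr rs).mp hR.isWeaklyRegular_rTensor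

theorem isWeaklyRegular_of_retract {s : N →ₗ[R] P} {p : P →ₗ[R] N}
    (hps : p ∘ₗ s = LinearMap.id) (hP : IsWeaklyRegular P rs) : IsWeaklyRegular N rs := by
  induction rs generalizing N P with
  | nil => exact .nil R N
  | cons r rs ih =>
    rw [isWeaklyRegular_cons_iff] at hP ⊢
    refine ⟨hP.1.of_injective s (LinearMap.injective_of_comp_eq_id s p hps),
      ih (s := QuotSMulTop.map r s) (p := QuotSMulTop.map r p) ?_ hP.2⟩
    rw [← QuotSMulTop.map_comp, hps, QuotSMulTop.map_id]

theorem smul_mem_smul_top_of_forall_mul_mem {I J : Ideal R} {t : R} (ht : ∀ r ∈ J, r * t ∈ I)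
    {y : P} (hy : y ∈ J • (⊤ : Submodule R P)) : t • y ∈ I • (⊤ : Submodule R P) := by
  induction hy using Submodule.smul_induction_on' with
  | smul r hr m _ =>
    rw [smul_smul, mul_comm]
    exact Submodule.smul_mem_smul (ht r hr) trivial
  | add x _ y _ hx hy =>
    rw [smul_add]
    exact add_mem hx hy

end WeaklyRegular

theorem not_hasNonzeroFreeSummand_ker {R : Type u} [CommRing R] [IsLocalRing R]
    [IsNoetherianRing R] {P : Type u} [AddCommGroup P] [Module R P] {N : Type*} [AddCommGroup N]
    [Module R N] {rs : List R} [Ring.KrullDimLE 0 (R ⧸ Ideal.ofList rs)] (hrs : Ideal.ofList rs ≠ ⊤)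
    {g : P →ₗ[R] N} (hg : Function.Surjective g) (hker : LinearMap.ker g ≤ maximalIdeal R • ⊤)
    (hN : IsWeaklyRegular N rs) : ¬ HasNonzeroFreeSummand R (LinearMap.ker g) := by
  rw [hasNonzeroFreeSummand_iff_exists_surjective]
  rintro ⟨φ, hφ⟩
  obtain ⟨e, he⟩ := hφ 1
  obtain ⟨t, ht, hmt⟩ := exists_notMem_forall_mul_mem hrs
  have hte : t • e ∈ Ideal.ofList rs • (⊤ : Submodule R (LinearMap.ker g)) :=
    mem_ofList_smul_top_of_exact (LinearMap.ker g).injective_subtype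
      (LinearMap.exact_subtype_ker_map g) hg hN
      (smul_mem_smul_top_of_forall_mul_mem hmt (hker e.2))
  have hφte : φ (t • e) ∈ Ideal.ofList rs • (⊤ : Submodule R R) :=
    Submodule.smul_top_le_comap_smul_top _ φ hte
  rw [map_smul, he, smul_eq_mul, smul_eq_mul, mul_one, Ideal.mul_top] at hφte
  exact ht hφte

namespace MinimalFreeResolution

variable {R : Type u} [CommRing R] [IsLocalRing R] {M : Type u} [AddCommGroup M] [Module R M]
  (F : MinimalFreeResolution R M)

/-- The surjection of the `n`-th free module of the resolution onto the `n`-th syzygy module. -/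
def cover : ∀ n : ℕ, (Fin (F.rank n) → R) →ₗ[R] F.syzygy n
  | 0 => F.ε.rangeRestrict
  | n + 1 => (F.d n).rangeRestrict

theorem cover_surjective (n : ℕ) : Function.Surjective (F.cover n) := by
  cases n <;> exact LinearMap.surjective_rangeRestrict _

theorem ker_cover (n : ℕ) : LinearMap.ker (F.cover n) = LinearMap.range (F.d n) := by
  cases n with
  | zero => exact (LinearMap.ker_rangeRestrict F.ε).trans F.exact_ε.linearMap_ker_eq
  | succ n => exact (LinearMap.ker_rangeRestrict (F.d n)).trans (F.exact_d n).linearMap_ker_eq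

/-- The augmentation identifies the zeroth syzygy module with the resolved module. -/
noncomputable def syzygyZeroEquiv : F.syzygy 0 ≃ₗ[R] M :=
  LinearEquiv.ofTop _ (LinearMap.range_eq_top.mpr F.surjective_ε)

variable {rs : List R}

theorem isWeaklyRegular_syzygy (hR : IsWeaklyRegular R rs) (hM : IsWeaklyRegular M rs) (n : ℕ) :
    IsWeaklyRegular (F.syzygy n) rs := by
  induction n with
  | zero => exact (F.syzygyZeroEquiv.isWeaklyRegular_congr rs).mpr hM
  | succ n ih =>
    exact isWeaklyRegular_of_exact (L := LinearMap.range (F.d n)) (Submodule.injective_subtype _)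
      (LinearMap.exact_iff.mpr ((F.ker_cover n).trans (Submodule.range_subtype _).symm))
      (F.cover_surjective n) (isWeaklyRegular_pi hR _) ih

theorem not_hasNonzeroFreeSummand_syzygy_succ [IsNoetherianRing R]
    [Ring.KrullDimLE 0 (R ⧸ Ideal.ofList rs)] (hR : IsRegular R rs) (hM : IsWeaklyRegular M rs)
    (n : ℕ) : ¬ HasNonzeroFreeSummand R (F.syzygy (n + 1)) := by
  have h := not_hasNonzeroFreeSummand_ker (ofList_ne_top hR) (F.cover_surjective n)
    ((F.ker_cover n).trans_le (F.minimal n)) (F.isWeaklyRegular_syzygy hR.1 hM n)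
  rwa [F.ker_cover n] at h

end MinimalFreeResolution

section QuotientIsomorphism

variable {R : Type u} [CommRing R] [IsLocalRing R]

theorem bijective_of_comp_eq_id {I : Submodule R R} {W : Type*} [AddCommGroup W] [Module R W]
    [Nontrivial W] {g : W →ₗ[R] R ⧸ I} {h : (R ⧸ I) →ₗ[R] W} (hgh : h ∘ₗ g = LinearMap.id) :
    Function.Bijective h := by
  have hgh' (w : W) : h (g w) = w := LinearMap.congr_fun hgh w
  obtain ⟨a, ha⟩ := I.mkQ_surjective (g (h (I.mkQ 1)))
  have hgha (y : R ⧸ I) : g (h y) = a • y := by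
    have heq : g ∘ₗ h = a • LinearMap.id := by
      refine Submodule.linearMap_qext _ (LinearMap.ext_ring ?_)
      calc g (h (I.mkQ 1)) = I.mkQ (a • 1) := by rw [← ha, smul_eq_mul, mul_one]
        _ = a • I.mkQ 1 := map_smul _ _ _
    exact LinearMap.congr_fun heq y
  have haW (w : W) : (1 - a) • w = 0 := by
    have haw : a • w = w := by
      rw [← hgh' (a • w), map_smul, ← hgha, hgh', hgh']
    rw [sub_smul, one_smul, haw, sub_self]
  obtain ⟨w, hw⟩ := exists_ne (0 : W)
  have ha_unit : IsUnit a := (isUnit_or_isUnit_one_sub_self a).resolve_right fun h1 =>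
    hw (h1.smul_eq_zero.mp (haW w))
  refine ⟨(injective_iff_map_eq_zero h).mpr fun y hy => ?_, fun w => ⟨g w, hgh' w⟩⟩
  rw [← ha_unit.smul_eq_zero, ← hgha, hy, map_zero]

variable [IsNoetherianRing R] {P N : Type*} [AddCommGroup P] [Module R P] [Module.Finite R P]
  [AddCommGroup N] [Module R N] [Module.Finite R N] {rs : List R}

theorem bijective_of_bijective_quotient (hN : IsRegular N rs) {φ : P →ₗ[R] N}
    {h : (P ⧸ Ideal.ofList rs • (⊤ : Submodule R P)) →ₗ[R]
      N ⧸ Ideal.ofList rs • (⊤ : Submodule R N)} (hh : Function.Bijective h)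
    (hφ : Submodule.mkQ _ ∘ₗ φ = h ∘ₗ Submodule.mkQ _) : Function.Bijective φ := by
  have hjac : Ideal.ofList rs ≤ Ideal.jacobson ⊥ :=
    (ofList_le_maximalIdeal hN).trans (maximalIdeal_le_jacobson _)
  have hsurj : Function.Surjective φ := by
    rw [← LinearMap.range_eq_top, ← top_le_iff]
    refine Submodule.le_of_le_smul_of_le_jacobson_bot Module.Finite.fg_top hjac fun x _ => ?_
    obtain ⟨y, hy⟩ := (hh.2.comp (Submodule.mkQ_surjective _)) (Submodule.mkQ _ x)
    have hxy : x - φ y ∈ Ideal.ofList rs • (⊤ : Submodule R N) :=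
      (Submodule.Quotient.eq _).mp (hy.symm.trans (LinearMap.congr_fun hφ y).symm)
    rw [← add_sub_cancel (φ y) x]
    exact Submodule.add_mem_sup ⟨y, rfl⟩ hxy
  have hker : LinearMap.ker φ = ⊥ := by
    have hle : (⊤ : Submodule R (LinearMap.ker φ)) ≤ Ideal.ofList rs • ⊤ := by
      rintro x -
      refine mem_ofList_smul_top_of_exact (LinearMap.ker φ).injective_subtype
        (LinearMap.exact_subtype_ker_map φ) hsurj hN.1 ((Submodule.Quotient.mk_eq_zero _).mp ?_)
      refine hh.1 ((LinearMap.congr_fun hφ x).symm.trans ?_)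
      rw [LinearMap.comp_apply, LinearMap.mem_ker.mp x.2, map_zero, map_zero]
    rw [← Submodule.subsingleton_iff_eq_bot, ← Submodule.subsingleton_iff R]
    exact subsingleton_of_bot_eq_top (Submodule.eq_bot_of_le_smul_of_le_jacobson_bot _ _
      Module.Finite.fg_top hle hjac).symm
  exact ⟨LinearMap.ker_eq_bot.mp hker, hsurj⟩

theorem nonempty_linearEquiv_of_bijective_quotient [Module.Projective R P] (hN : IsRegular N rs)
    {h : (P ⧸ Ideal.ofList rs • (⊤ : Submodule R P)) →ₗ[R]
      N ⧸ Ideal.ofList rs • (⊤ : Submodule R N)} (hh : Function.Bijective h) :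
    Nonempty (P ≃ₗ[R] N) := by
  obtain ⟨φ, hφ⟩ := Module.projective_lifting_property (Submodule.mkQ _)
    (h ∘ₗ Submodule.mkQ _) (Submodule.mkQ_surjective (Ideal.ofList rs • (⊤ : Submodule R N)))
  exact ⟨.ofBijective φ (bijective_of_bijective_quotient hN hh hφ)⟩

end QuotientIsomorphism

theorem IsCohenMacaulay.exists_isRegular {R : Type u} [CommRing R] [IsLocalRing R]
    [IsNoetherianRing R] (hR : IsCohenMacaulay R) :
    ∃ rs : List R, IsRegular R rs ∧ ringKrullDim R = rs.length := by
  have hlt : depth R R < ⊤ :=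
    WithBot.coe_lt_coe.mp (hR.trans_lt ringKrullDim_lt_top)
  have : Nonempty {rs : List R // (∀ r ∈ rs, r ∈ maximalIdeal R) ∧ IsRegular R rs} :=
    ⟨⟨[], by simp, .nil R R⟩⟩
  obtain ⟨⟨rs, _, hreg⟩, hrs⟩ := ENat.exists_eq_iSup_of_lt_top hlt
  exact ⟨rs, hreg, hR.symm.trans (congrArg _ hrs.symm)⟩

namespace IsCanonicalModule

variable {R : Type u} [CommRing R] [IsLocalRing R] {ω : Type u} [AddCommGroup ω] [Module R ω]
  (hω : IsCanonicalModule R ω)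
include hω

theorem subsingleton_ext {i : ℕ} (hi : (i : WithBot ℕ∞) ≠ ringKrullDim R) :
    Subsingleton (Ext (ModuleCat.of R (ResidueField R)) (ModuleCat.of R ω) i) := by
  have h := hω.length_ext i
  rwa [if_neg hi, Module.length_eq_zero_iff] at h

theorem isSimpleModule_ext {i : ℕ} (hi : (i : WithBot ℕ∞) = ringKrullDim R) :
    IsSimpleModule R (Ext (ModuleCat.of R (ResidueField R)) (ModuleCat.of R ω) i) := by
  have h := hω.length_ext i
  rwa [if_pos hi, Module.length_eq_one_iff] at h

theorem nontrivial {i : ℕ} (hi : (i : WithBot ℕ∞) = ringKrullDim R) : Nontrivial ω := by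
  have := hω.isSimpleModule_ext hi
  have := IsSimpleModule.nontrivial R
    (Ext (ModuleCat.of R (ResidueField R)) (ModuleCat.of R ω) i)
  obtain ⟨x, hx⟩ :=
    exists_ne (0 : Ext (ModuleCat.of R (ResidueField R)) (ModuleCat.of R ω) i)
  by_contra! hsub
  have hid : 𝟙 (ModuleCat.of R ω) = 0 := (ModuleCat.isZero_of_subsingleton _).eq_of_src _ _
  exact hx (by rw [← Ext.comp_mk₀_id x, hid, Ext.mk₀_zero, Ext.comp_zero])

variable [IsNoetherianRing R]

theorem hasInjectiveDimensionLE {d : ℕ} (hd : ringKrullDim R = d) :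
    HasInjectiveDimensionLE (ModuleCat.of R ω) d := by
  have := hω.finite
  exact hasInjectiveDimensionLE_of_subsingleton_ext_residueField fun i hi =>
    hω.subsingleton_ext (by rw [hd]; exact_mod_cast hi.ne')

variable {rs : List R}

theorem isSimpleModule_socle (hrs : IsRegular ω rs) (hd : ringKrullDim R = rs.length) :
    IsSimpleModule R
      (ResidueField R →ₗ[R] ω ⧸ Ideal.ofList rs • (⊤ : Submodule R ω)) := by
  have := hω.finite
  have := hω.isSimpleModule_ext hd.symm
  obtain ⟨e⟩ := nonempty_linearMap_quotient_equiv_ext (M := ResidueField R)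
    ((ofList_le_maximalIdeal hrs).trans annihilator_residueField.ge) hrs
  exact .congr e

theorem isGorenstein_of_surjective {d : ℕ} (hd : ringKrullDim R = d) {φ : ω →ₗ[R] R}
    (hφ : Function.Surjective φ) : IsGorenstein R := by
  obtain ⟨s, hs⟩ := φ.exists_rightInverse_of_surjective (LinearMap.range_eq_top.mpr hφ)
  let r : Retract (ModuleCat.of R R) (ModuleCat.of R ω) :=
    { i := ModuleCat.ofHom s, r := ModuleCat.ofHom φ, retract := ModuleCat.hom_ext hs }
  have := hω.hasInjectiveDimensionLE hd
  exact ⟨d, r.hasInjectiveDimensionLT (d + 1)⟩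

theorem nonempty_linearEquiv_of_isGorenstein (hG : IsGorenstein R) (hR : IsRegular R rs)
    (hrs : IsRegular ω rs) (hd : ringKrullDim R = rs.length) : Nonempty (R ≃ₗ[R] ω) := by
  have := hω.finite
  have := krullDimLE_zero_quotient_ofList hR hd
  have := hω.isSimpleModule_socle hrs hd
  have := hω.hasInjectiveDimensionLE hd
  obtain ⟨n, hn⟩ := hG
  have := hasInjectiveDimensionLE_length hR hn
  have := hR.quot_ofList_smul_nontrivial ⊤
  have := hrs.quot_ofList_smul_nontrivial ⊤
  have : IsSimpleModule R (ResidueField R) :=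
    isSimpleModule_iff_isCoatom.mpr (maximalIdeal.isMaximal R).out
  have := IsSimpleModule.nontrivial R
    (ResidueField R →ₗ[R] ω ⧸ Ideal.ofList rs • (⊤ : Submodule R ω))
  obtain ⟨j, hj⟩ := exists_ne
    (0 : ResidueField R →ₗ[R] ω ⧸ Ideal.ofList rs • (⊤ : Submodule R ω))
  obtain ⟨s, hs⟩ := exists_injective_residueField (Ideal.ofList rs)
    (le_annihilator_quotient_smul_top (Ideal.ofList rs) R)
  obtain ⟨g, rfl⟩ := exists_extension_of_hasInjectiveDimensionLE_length hR
    (le_annihilator_quotient_smul_top (Ideal.ofList rs) ω) (LinearMap.injective_of_ne_zero hj) s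
  have hg : Function.Injective g := injective_of_isSimpleModule_socle (Ideal.ofList rs)
    (le_annihilator_quotient_smul_top _ ω) fun h => one_ne_zero (hs (by rw [h]; rfl))
  obtain ⟨p, hp⟩ := exists_extension_of_hasInjectiveDimensionLE_length hrs
    (le_annihilator_quotient_smul_top (Ideal.ofList rs) R) hg LinearMap.id
  exact nonempty_linearEquiv_of_bijective_quotient hrs (bijective_of_comp_eq_id hp)

theorem exists_isRegular (hR : IsCohenMacaulay R) :
    ∃ rs : List R, IsRegular R rs ∧ IsRegular ω rs ∧ ringKrullDim R = rs.length := by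
  obtain ⟨rs, hrs, hd⟩ := hR.exists_isRegular
  have := hω.finite
  have := hω.nontrivial hd.symm
  have hExt : ∀ i < rs.length,
      Subsingleton (Ext (ModuleCat.of R (ResidueField R)) (ModuleCat.of R (R × ω)) i) := by
    intro i hi
    have := subsingleton_ext_of_isRegular (M := ModuleCat.of R (ResidueField R))
      (N := ModuleCat.of R R)
      ((ofList_le_maximalIdeal hrs).trans annihilator_residueField.ge) hrs hi
    have := hω.subsingleton_ext (i := i) (by rw [hd]; exact_mod_cast hi.ne)
    exact subsingleton_ext_prod i
  have hsupp : Module.support R (ResidueField R) = PrimeSpectrum.zeroLocus (maximalIdeal R) := by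
    rw [Module.support_eq_zeroLocus, annihilator_residueField]
  have hlt : maximalIdeal R • (⊤ : Submodule R (R × ω)) < ⊤ := by
    rw [lt_top_iff_ne_top]
    intro h
    exact top_ne_bot (Submodule.eq_bot_of_le_smul_of_le_jacobson_bot _ _ Module.Finite.fg_top h.ge
      (maximalIdeal_le_jacobson _))
  obtain ⟨rs', hlen, hmem, hreg⟩ := ModuleCat.exists_isRegular_of_exists_subsingleton_ext
    (maximalIdeal R) rs.length (ModuleCat.of R (R × ω)) hlt (ModuleCat.of R (ResidueField R))
    hsupp hExt
  exact ⟨rs',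
    .of_isWeaklyRegular_of_mem_maximalIdeal R hmem
      (isWeaklyRegular_of_retract (LinearMap.fst_comp_inl R R ω) hreg.1),
    .of_isWeaklyRegular_of_mem_maximalIdeal ω hmem
      (isWeaklyRegular_of_retract (LinearMap.snd_comp_inr R R ω) hreg.1), hlen ▸ hd⟩

end IsCanonicalModule

end LocalAlgebra

theorem corollary3p6 (R : Type u) [CommRing R] [IsLocalRing R] [IsNoetherianRing R]
    (hR : LocalAlgebra.IsCohenMacaulay R) (ω : Type u) [AddCommGroup ω] [Module R ω]
    (hω : LocalAlgebra.IsCanonicalModule R ω) (F : LocalAlgebra.MinimalFreeResolution R ω) :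
    LocalAlgebra.IsGorenstein R ↔
      ∃ n : ℕ, LocalAlgebra.HasNonzeroFreeSummand R (F.syzygy n) := by
  obtain ⟨rs, hRrs, hωrs, hd⟩ := hω.exists_isRegular hR
  have := LocalAlgebra.krullDimLE_zero_quotient_ofList hRrs hd
  constructor
  · intro hG
    obtain ⟨e⟩ := hω.nonempty_linearEquiv_of_isGorenstein hG hRrs hωrs hd
    exact ⟨0, LocalAlgebra.hasNonzeroFreeSummand_iff_exists_surjective.mpr
      ⟨F.syzygyZeroEquiv ≪≫ₗ e.symm, (F.syzygyZeroEquiv ≪≫ₗ e.symm).surjective⟩⟩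
  · rintro ⟨_ | n, hn⟩
    · obtain ⟨φ, hφ⟩ := LocalAlgebra.hasNonzeroFreeSummand_iff_exists_surjective.mp hn
      exact hω.isGorenstein_of_surjective hd (φ := φ ∘ₗ F.syzygyZeroEquiv.symm)
        (hφ.comp F.syzygyZeroEquiv.symm.surjective)
    · exact absurd hn (F.not_hasNonzeroFreeSummand_syzygy_succ hRrs hωrs.1 n)
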